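/- Let $P^+(q)$ be the space of symmetric positive definite real $q\times q$ matrices, with reference measure $\mu(dS)=\det(S)^{-(q+1)/2}\prod_{1\le i\le j\le q}dS_{ij}$, and let $p\ge q$, $\rho\in[0,1)$. For $A,B\in P^+(q)$ put $A\circ B=B^{1/2}AB^{1/2}$. Let $\mathcal L$ be the law on $P^+(q)$ given by $$\mathcal L(d\epsilon)=(1-\rho)^{pq/2}\,\frac{\Gamma_q(p)}{\Gamma_q(p/2)^2}\;\mu(d\epsilon)\int_{\mathcal O(p,q)}\frac{\det(\epsilon)^{p/2}}{\det\big(I_q+\epsilon-\rho^{1/2}(\mathsf U_1\epsilon^{1/2}+\epsilon^{1/2}\mathsf U_1^{\top})\big)^{p}}\,d\mathsf U ,$$ where $\Gamma_q$ is the multivariate Gamma function, $d\mathsf U$ is the uniform probability distribution on $\mathcal O(p,q)=\{\mathsf U\in\mathbb R^{p\times q}:\mathsf U^\top\mathsf U=I_q\}$ and $\mathsf U_1$ consists of the first $q$ rows of $\mathsf U$. Let $\tilde Q(S,\cdot)=\tilde Q(S,\cdot\,;\rho,p)$ be the law of $\epsilon\circ S$, $\epsilon\sim\mathcal L$. For a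 probability measure $\tilde\Pi(dS)=\tilde\pi(S)\mu(dS)$ on $P^+(q)$, with a given version of its density $\tilde\pi:P^+(q)\to[0,\infty)$, the MpCN kernel with target $\tilde\Pi$ and proposal $\tilde Q$ is the Metropolis kernel $$\tilde P(S,A)=\int_A\alpha(S,S^*)\,\tilde Q(S,dS^*)+\Big(1-\int\alpha(S,S^*)\,\tilde Q(S,dS^*)\Big)\delta_S(A),\qquad \alpha(S,S^*)=\min\{1,\tilde\pi(S^*)/\tilde\pi(S)\}$$ ($\alpha(S,S^*)=1$ if $\tilde\pi(S)=0$). Let $\tilde\Pi_{-1}$ be the image of $\tilde\Pi$ under $S\mapsto S^{-1}$. A Markov kernel $P$ is called geometrically ergodic if there are a probability measure $\Pi$ and $r\in(0,1)$ such that $V(x)=\sup_{n\ge0}r^{-n}\|P^n(x,\cdot)-\Pi\|_{\mathrm{TV}}$ is $\Pi$-integrable, where $\|\mu-\nu\|_{\mathrm{TV}}=\sup_A|\mu(A)-\nu(A)|$. (1) $\tilde\Pi_{-1}$ has density $S\mapsto\tilde\pi(S^{-1})$ with respect to $\mu$; and if $\{S_n\}_{n\ge0}$ is a Markov process (with respect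 to its own filtration, with any initial law) whose transition kernel is the MpCN kernel with target $\tilde\Pi$ and proposal $\tilde Q(\cdot\,;\rho,p)$, then $\{S_n^{-1}\}_{n\ge0}$ is a Markov process (with respect to its own filtration) whose transition kernel is the MpCN kernel with target $\tilde\Pi_{-1}$ (with the density $S\mapsto\tilde\pi(S^{-1})$) and the same proposal $\tilde Q(\cdot\,;\rho,p)$. (2) The MpCN kernel with target $\tilde\Pi$ is geometrically ergodic if and only if the MpCN kernel with target $\tilde\Pi_{-1}$ (same $\rho$, $p$) is. (3) Let $r\in\mathbb R$, $r>q-1$, $T\in P^+(q)$. Let $W_q(r,T)$ and $W_q^{-1}(r,T)$ be the Wishart and Inverse-Wishart laws, with densities with respect to $\mu$ $$\frac{\det(S)^{r/2}e^{-\operatorname{tr}[T^{-1}S]/2}}{2^{rq/2}(\det T)^{r/2}\Gamma_q(r/2)}\qquad\text{and}\qquad\frac{(\det T)^{r/2}e^{-\operatorname{tr}[TS^{-1}]/2}}{2^{rq/2}\det(S)^{r/2}\Gamma_q(r/2)} .$$ Then the image of $W_q(r,T)$ under $S\mapsto S^{-1}$ is $W_q^{-1}(r,T^{-1})$, and the MpCN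 kernel with target $W_q(r,T)$ is geometrically ergodic if and only if the MpCN kernel with target $W_q^{-1}(r,T^{-1})$ (same $\rho$, $p$) is. -/

import Mathlib

open MeasureTheory ProbabilityTheory
open scoped ENNReal NNReal

namespace MpCN

/-! ### The cone of positive definite matrices -/

section Cone

open scoped MatrixOrder

/-- The space `P⁺(q)` of symmetric positive definite `q × q` real matrices. -/
abbrev SPD (q : ℕ) : Type := {S : Matrix (Fin q) (Fin q) ℝ // S.PosDef}

instance (q : ℕ) : MeasurableSpace (SPD q) := borel _

instance (q : ℕ) : BorelSpace (SPD q) := ⟨rfl⟩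

/-- Matrix inversion on `P⁺(q)`. -/
noncomputable instance (q : ℕ) : Inv (SPD q) := ⟨fun S => ⟨S.1⁻¹, S.2.inv⟩⟩

theorem measurableSet_posDef (q : ℕ) :
    @MeasurableSet _ (borel (Matrix (Fin q) (Fin q) ℝ)) {A | A.PosDef} := by
  let _ : MeasurableSpace (Matrix (Fin q) (Fin q) ℝ) := borel _
  have _ : BorelSpace (Matrix (Fin q) (Fin q) ℝ) := ⟨rfl⟩
  have h : {A : Matrix (Fin q) (Fin q) ℝ | A.PosDef} =
      ({A | A.IsHermitian} ∩ ⋂ x : Fin q → ℝ, {A | 0 ≤ star x ⬝ᵥ (A.mulVec x)}) ∩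
        {A | A.det ≠ 0} := by
    ext A
    simp only [Set.mem_ofPred_eq, Set.mem_inter_iff, Set.mem_iInter]
    constructor
    · intro hA
      exact ⟨⟨hA.1, fun x => hA.posSemidef.dotProduct_mulVec_nonneg x⟩, hA.det_pos.ne'⟩
    · rintro ⟨⟨h1, h2⟩, h3⟩
      exact (Matrix.PosSemidef.of_dotProduct_mulVec_nonneg h1 h2).posDef_iff_det_ne_zero.mpr h3
  rw [h]
  refine ((IsClosed.inter ?_ (isClosed_iInter fun x => ?_)).measurableSet).inter
    (IsOpen.measurableSet ?_)
  · exact isClosed_eq (by fun_prop) continuous_id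
  · exact isClosed_le continuous_const (by fun_prop)
  · exact isOpen_ne_fun (by fun_prop) continuous_const

instance (q : ℕ) : SecondCountableTopology (Matrix (Fin q) (Fin q) ℝ) :=
  inferInstanceAs (SecondCountableTopology (Fin q → Fin q → ℝ))

instance (q : ℕ) : SecondCountableTopology (SPD q) :=
  TopologicalSpace.Subtype.secondCountableTopology {S : Matrix (Fin q) (Fin q) ℝ | S.PosDef}

instance (q : ℕ) : PolishSpace (Matrix (Fin q) (Fin q) ℝ) :=
  inferInstanceAs (PolishSpace (Fin q → Fin q → ℝ))

instance (q : ℕ) : StandardBorelSpace (SPD q) := by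
  let _ : MeasurableSpace (Matrix (Fin q) (Fin q) ℝ) := borel _
  have _ : BorelSpace (Matrix (Fin q) (Fin q) ℝ) := ⟨rfl⟩
  have h : @StandardBorelSpace (SPD q) Subtype.instMeasurableSpace :=
    (measurableSet_posDef q).standardBorel
  have e : Subtype.instMeasurableSpace = borel (SPD q) :=
    (borel_comap (f := (Subtype.val : SPD q → Matrix (Fin q) (Fin q) ℝ))).symm
  change @StandardBorelSpace (SPD q) (borel (SPD q))
  rw [← e]
  exact h

/-- The square root `S^{1/2}`: the element of `P⁺(q)` whose square is `S`. -/
noncomputable def sqrt {q : ℕ} (S : SPD q) : SPD q :=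
  ⟨CFC.sqrt S.1, by
    have h0 : (CFC.sqrt S.1).PosSemidef := 
      Matrix.nonneg_iff_posSemidef.mp (CFC.sqrt_nonneg S.1)
    refine h0.posDef_iff_det_ne_zero.mpr fun h => S.2.det_pos.ne' ?_
    rw [← CFC.sqrt_mul_sqrt_self S.1 S.2.posSemidef.nonneg, Matrix.det_mul, h, zero_mul]⟩

theorem sqrt_mul_sqrt {q : ℕ} (S : SPD q) : (sqrt S).1 * (sqrt S).1 = S.1 :=
  CFC.sqrt_mul_sqrt_self S.1 S.2.posSemidef.nonneg

theorem measurable_sqrt {q : ℕ} : Measurable (sqrt : SPD q → SPD q) := by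
  let sqr : SPD q → SPD q := fun S => ⟨S.1 * S.1, by
    have h := S.2.isHermitian
    have h2 : (S.1.conjTranspose * S.1).PosSemidef := Matrix.posSemidef_conjTranspose_mul_self _
    rw [h.eq] at h2
    refine h2.posDef_iff_det_ne_zero.mpr ?_
    rw [Matrix.det_mul]
    exact (mul_pos S.2.det_pos S.2.det_pos).ne'⟩
  have hr : ∀ S, sqr (sqrt S) = S := fun S => Subtype.ext (sqrt_mul_sqrt S)
  have hl : ∀ S, sqrt (sqr S) = S := fun S =>
    Subtype.ext (CFC.sqrt_mul_self S.1 S.2.posSemidef.nonneg)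
  have hc : Continuous sqr := by
    refine Continuous.subtype_mk ?_ _
    exact continuous_subtype_val.mul continuous_subtype_val
  have he : MeasurableEmbedding sqr :=
    hc.measurable.measurableEmbedding (Function.LeftInverse.injective hl)
  intro A hA
  have : sqrt ⁻¹' A = sqr '' A := by
    ext S
    exact ⟨fun h => ⟨sqrt S, h, hr S⟩, by rintro ⟨T, hT, rfl⟩; simpa [hl] using hT⟩
  rw [this]
  exact he.measurableSet_image.mpr hA

theorem posDef_mul_mul {q : ℕ} (B A : SPD q) : (B.1 * A.1 * B.1).PosDef := by
  have h := A.2.posSemidef.conjTranspose_mul_mul_same B.1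
  rw [B.2.isHermitian.eq] at h
  refine h.posDef_iff_det_ne_zero.mpr ?_
  rw [Matrix.det_mul, Matrix.det_mul]
  exact (mul_pos (mul_pos B.2.det_pos A.2.det_pos) B.2.det_pos).ne'

/-- The operation `A ∘ B = B^{1/2} A B^{1/2}` on `P⁺(q)`. -/
noncomputable def circ {q : ℕ} (A B : SPD q) : SPD q :=
  ⟨(sqrt B).1 * A.1 * (sqrt B).1, posDef_mul_mul (sqrt B) A⟩

theorem measurable_circ {q : ℕ} : Measurable fun x : SPD q × SPD q => circ x.2 x.1 := by
  have hc : Continuous fun x : SPD q × SPD q =>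
      (⟨x.1.1 * x.2.1 * x.1.1, posDef_mul_mul x.1 x.2⟩ : SPD q) :=
    Continuous.subtype_mk (by fun_prop) _
  have hm : Measurable fun x : SPD q × SPD q => (sqrt x.1, x.2) :=
    (measurable_sqrt.comp measurable_fst).prodMk measurable_snd
  have h := hc.measurable.comp hm
  have e : (fun x : SPD q × SPD q => circ x.2 x.1) =
      (fun x : SPD q × SPD q => (⟨x.1.1 * x.2.1 * x.1.1, posDef_mul_mul x.1 x.2⟩ : SPD q)) ∘
        fun x => (sqrt x.1, x.2) := by
    funext x; rfl
  rw [e]; exact h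

end Cone

/-! ### Reference measures -/

section Reference

/-- The coordinates `S_{ij}`, `i ≤ j`, of a symmetric matrix. -/
def upperCoords {q : ℕ} (S : SPD q) : {ij : Fin q × Fin q // ij.1 ≤ ij.2} → ℝ :=
  fun ij => S.1 ij.1.1 ij.1.2

theorem measurableEmbedding_upperCoords (q : ℕ) :
    MeasurableEmbedding (upperCoords (q := q)) := by
  have hc : Continuous (upperCoords (q := q)) :=
    continuous_pi fun ij => continuous_subtype_val.matrix_elem _ _
  refine hc.measurable.measurableEmbedding fun S T h => Subtype.ext (Matrix.ext fun i j => ?_)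
  have hS : S.1 j i = S.1 i j := by simpa using S.2.isHermitian.apply i j
  have hT : T.1 j i = T.1 i j := by simpa using T.2.isHermitian.apply i j
  rcases le_total i j with hij | hij
  · exact congrFun h ⟨(i, j), hij⟩
  · rw [← hS, ← hT]
    exact congrFun h ⟨(j, i), hij⟩

/-- The Lebesgue measure `∏_{i ≤ j} dS_{ij}` on `P⁺(q)`. -/
noncomputable def lebSPD (q : ℕ) : Measure (SPD q) := Measure.comap upperCoords volume

instance (q : ℕ) : SigmaFinite (lebSPD q) := by
  have h := measurableEmbedding_upperCoords q
  refine SigmaFinite.of_map (lebSPD q) h.measurable.aemeasurable ?_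
  rw [lebSPD, h.map_comap]
  infer_instance

/-- The reference measure `μ(dS) = det(S)^{-(q+1)/2} ∏_{i ≤ j} dS_{ij}` on `P⁺(q)`. -/
noncomputable def refMeasure (q : ℕ) : Measure (SPD q) :=
  (lebSPD q).withDensity fun S => ENNReal.ofReal (S.1.det ^ (-((q : ℝ) + 1) / 2))

instance (q : ℕ) : SFinite (refMeasure q) := by
  unfold refMeasure; infer_instance

instance (p : ℕ) : CompactSpace (Matrix.orthogonalGroup (Fin p) ℝ) := by
  refine (isCompact_iff_compactSpace (X := Matrix (Fin p) (Fin p) ℝ)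
    (s := (Matrix.orthogonalGroup (Fin p) ℝ : Set (Matrix (Fin p) (Fin p) ℝ)))).mp ?_
  have hK : IsCompact (Set.univ.pi fun _ => Set.univ.pi fun _ => Set.Icc (-1) 1 :
      Set (Fin p → Fin p → ℝ)) :=
    isCompact_univ_pi fun _ => isCompact_univ_pi fun _ => isCompact_Icc
  refine IsCompact.of_isClosed_subset hK (isClosed_unitary (R := Matrix (Fin p) (Fin p) ℝ)) ?_
  intro U hU i _ j _
  have := entry_norm_bound_of_unitary (𝕜 := ℝ) hU i j
  rw [Real.norm_eq_abs, abs_le] at this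
  exact this

instance (p : ℕ) : MeasurableSpace (Matrix.orthogonalGroup (Fin p) ℝ) := borel _

instance (p : ℕ) : BorelSpace (Matrix.orthogonalGroup (Fin p) ℝ) := ⟨rfl⟩

/-- The space `O(p,q)` of `p × q` matrices `U` with `Uᵀ U = I_q`. -/
abbrev Stiefel (p q : ℕ) : Type := {U : Matrix (Fin p) (Fin q) ℝ // U.transpose * U = 1}

instance (p q : ℕ) : MeasurableSpace (Stiefel p q) := borel _

instance (p q : ℕ) : BorelSpace (Stiefel p q) := ⟨rfl⟩

/-- The first `q` columns of an orthogonal `p × p` matrix. -/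
def firstColumns {p q : ℕ} (hqp : q ≤ p) (g : Matrix.orthogonalGroup (Fin p) ℝ) : Stiefel p q :=
  ⟨g.1.submatrix id (Fin.castLE hqp), by
    have h : g.1.transpose * g.1 = 1 := (Matrix.mem_orthogonalGroup_iff' (Fin p) ℝ).mp g.2
    ext i j
    have := congrFun (congrFun h (Fin.castLE hqp i)) (Fin.castLE hqp j)
    simpa [Matrix.mul_apply, Matrix.one_apply] using this⟩

/-- The uniform probability distribution `dU` on `O(p,q)`, `q ≤ p`: the law of the first `q`
columns of a random matrix distributed according to the Haar probability measure on `O(p)`. -/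
noncomputable def stiefelUniform {p q : ℕ} (hqp : q ≤ p) : Measure (Stiefel p q) :=
  (Measure.haarMeasure (⊤ : TopologicalSpace.PositiveCompacts
    (Matrix.orthogonalGroup (Fin p) ℝ))).map (firstColumns hqp)

/-- The multivariate Gamma function `Γ_q(a) = π^{q(q-1)/4} ∏_{j=1}^q Γ(a - (j-1)/2)`. -/
noncomputable def multiGamma (q : ℕ) (a : ℝ) : ℝ :=
  Real.pi ^ ((q : ℝ) * ((q : ℝ) - 1) / 4) * ∏ j : Fin q, Real.Gamma (a - (j : ℝ) / 2)

end Reference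

/-! ### Wishart and Inverse-Wishart laws -/

section Wishart

/-- The density of the Wishart distribution `W_q(r,T)` with respect to `refMeasure q`. -/
noncomputable def wishartDensity {q : ℕ} (r : ℝ) (T S : SPD q) : ℝ≥0 :=
  Real.toNNReal (S.1.det ^ (r / 2) * Real.exp (-(T.1⁻¹ * S.1).trace / 2) /
    (2 ^ (r * q / 2) * T.1.det ^ (r / 2) * multiGamma q (r / 2)))

/-- The density of the Inverse-Wishart distribution `W_q^{-1}(r,T)` with respect to
`refMeasure q`. -/
noncomputable def invWishartDensity {q : ℕ} (r : ℝ) (T S : SPD q) : ℝ≥0 :=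
  Real.toNNReal (T.1.det ^ (r / 2) * Real.exp (-(T.1 * S.1⁻¹).trace / 2) /
    (2 ^ (r * q / 2) * S.1.det ^ (r / 2) * multiGamma q (r / 2)))

/-- The Wishart distribution `W_q(r,T)`. -/
noncomputable def wishart {q : ℕ} (r : ℝ) (T : SPD q) : Measure (SPD q) :=
  (refMeasure q).withDensity fun S => (wishartDensity r T S : ℝ≥0∞)

/-- The Inverse-Wishart distribution `W_q^{-1}(r,T)`. -/
noncomputable def invWishart {q : ℕ} (r : ℝ) (T : SPD q) : Measure (SPD q) :=
  (refMeasure q).withDensity fun S => (invWishartDensity r T S : ℝ≥0∞)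

end Wishart

/-! ### Metropolis kernels and the MpCN kernel on `P⁺(q)` -/

section Kernels

variable {E : Type*} [MeasurableSpace E]

/-- `π` is (a version of) the density of the target `Pi` with respect to `ξ`. -/
def HasDensity (Pi ξ : Measure E) (π : E → ℝ≥0) : Prop :=
  Measurable π ∧ Pi = ξ.withDensity fun x => (π x : ℝ≥0∞)

/-- The acceptance probability `α(x,y) = min{1, π(y)/π(x)}`, with the usual convention
`α(x,y) = 1` when `π(x) = 0`. -/
noncomputable def acceptProb (π : E → ℝ≥0) (x y : E) : ℝ≥0∞ :=
  if π x = 0 then 1 else ((min 1 (π y / π x) : ℝ≥0) : ℝ≥0∞)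

/-- The Metropolis kernel `P(x,dy) = Q(x,dy) α(x,y) + R(x) δ_x(dy)`,
`R(x) = 1 - ∫ Q(x,dy) α(x,y)`, with proposal `Q`, which is reversible with respect to a
reference measure for which the target has the measurable density `π`. -/
noncomputable def metropolisKernel (Q : Kernel E E) [IsSFiniteKernel Q] (π : E → ℝ≥0) :
    Kernel E E :=
  Kernel.withDensity Q (acceptProb π) +
    Kernel.withDensity Kernel.id fun x _ => 1 - ∫⁻ y, acceptProb π x y ∂(Q x)

theorem measurable_acceptProb {π : E → ℝ≥0} (hπ : Measurable π) :
    Measurable (Function.uncurry (acceptProb π)) := by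
  unfold Function.uncurry acceptProb
  refine Measurable.ite ?_ measurable_const ?_
  · exact measurableSet_eq_fun (hπ.comp measurable_fst) measurable_const
  · exact (measurable_const.min
      ((hπ.comp measurable_snd).div (hπ.comp measurable_fst))).coe_nnreal_ennreal

theorem metropolisKernel_apply (Q : Kernel E E) [IsSFiniteKernel Q] {π : E → ℝ≥0}
    (hπ : Measurable π) (x : E) (A : Set E) :
    metropolisKernel Q π x A = ∫⁻ y in A, acceptProb π x y ∂(Q x) +
      (1 - ∫⁻ y, acceptProb π x y ∂(Q x)) * Measure.dirac x A := by
  have h := measurable_acceptProb hπ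
  have hR : Measurable fun x => 1 - ∫⁻ y, acceptProb π x y ∂(Q x) :=
    measurable_const.sub (h.lintegral_kernel_prod_right)
  rw [metropolisKernel, _root_.add_apply, Measure.add_apply, Kernel.withDensity_apply' _ h,
    Kernel.withDensity_apply' _ (by exact hR.comp measurable_fst), lintegral_const,
    Kernel.id_apply, Measure.restrict_apply_univ]

variable {p q : ℕ}

/-- The density of the increment law with respect to `refMeasure q`:
`(1-ρ)^{pq/2} c_{p,q} ∫_{O(p,q)} det(ε)^{p/2} / det(I + ε - ρ^{1/2}(U₁ ε^{1/2} + ε^{1/2} U₁ᵀ))^p dU`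
where `c_{p,q} = Γ_q(p) / Γ_q(p/2)^2` and `U₁` consists of the first `q` rows of `U`. -/
noncomputable def incrementDensity (hqp : q ≤ p) (ρ : ℝ) (ε : SPD q) : ℝ≥0∞ :=
  ENNReal.ofReal ((1 - ρ) ^ ((p : ℝ) * q / 2) *
      (multiGamma q p / multiGamma q ((p : ℝ) / 2) ^ 2)) *
    ∫⁻ U : Stiefel p q,
      (let U₁ : Matrix (Fin q) (Fin q) ℝ := U.1.submatrix (Fin.castLE hqp) id
       ENNReal.ofReal (ε.1.det ^ ((p : ℝ) / 2) /
        (1 + ε.1 - √ρ • (U₁ * (sqrt ε).1 + (sqrt ε).1 * U₁.transpose)).det ^ p))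
      ∂(stiefelUniform hqp)

/-- The law `L(dε)` of the increments of the MpCN proposal on `P⁺(q)`. -/
noncomputable def incrementLaw (hqp : q ≤ p) (ρ : ℝ) : Measure (SPD q) :=
  (refMeasure q).withDensity (incrementDensity hqp ρ)

instance (hqp : q ≤ p) (ρ : ℝ) : SFinite (incrementLaw hqp ρ) := by
  unfold incrementLaw; infer_instance

/-- The MpCN proposal kernel `Q̃(·;ρ,p)` on `P⁺(q)`: `Q̃(S,·)` is the law of `ε ∘ S`, where `ε`
has law `incrementLaw hqp ρ`. -/
noncomputable def proposal (hqp : q ≤ p) (ρ : ℝ) : Kernel (SPD q) (SPD q) where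
  toFun S := (incrementLaw hqp ρ).map fun ε => circ ε S
  measurable' := by
    have h : ∀ S : SPD q, (incrementLaw hqp ρ).map (fun ε => circ ε S) =
        ((incrementLaw hqp ρ).map (Prod.mk S)).map fun x => circ x.2 x.1 := fun S => by
      rw [Measure.map_map measurable_circ measurable_prodMk_left]; rfl
    simp_rw [h]
    exact (Measure.measurable_map _ measurable_circ).comp Measurable.map_prodMk_left

instance (hqp : q ≤ p) (ρ : ℝ) : IsSFiniteKernel (proposal hqp ρ) := by
  have h : proposal hqp ρ =
      (Kernel.id ×ₖ Kernel.const (SPD q) (incrementLaw hqp ρ)).map fun x => circ x.2 x.1 := by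
    ext1 S
    rw [Kernel.map_apply _ measurable_circ, Kernel.prod_apply, Kernel.id_apply,
      Kernel.const_apply, Measure.dirac_prod, Measure.map_map measurable_circ
        measurable_prodMk_left]
    rfl
  rw [h]; infer_instance

/-- The MpCN kernel on `P⁺(q)` with proposal `Q̃(·;ρ,p)` and target with density `π` with respect
to `refMeasure q`: the Metropolis kernel of the triplet `(Π, Q̃, refMeasure q)`. -/
noncomputable def mpcnKernel (hqp : q ≤ p) (ρ : ℝ) (π : SPD q → ℝ≥0) : Kernel (SPD q) (SPD q) :=
  metropolisKernel (proposal hqp ρ) π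

end Kernels

/-! ### Markov chains and geometric ergodicity -/

section Markov

variable {E : Type*} [MeasurableSpace E]

/-- `X` is a (time-homogeneous) Markov process with transition kernel `K` under `Pr`, with respect
to its own filtration; the initial law is arbitrary. -/
def IsMarkovChain {Ω : Type*} [MeasurableSpace Ω] (Pr : Measure Ω) (X : ℕ → Ω → E)
    (K : Kernel E E) : Prop :=
  (∀ n, Measurable (X n)) ∧
    ∀ (n : ℕ) (A : Set E), MeasurableSet A →
      condExp (⨆ i ≤ n, MeasurableSpace.comap (X i) inferInstance) Pr
          ((X (n + 1) ⁻¹' A).indicator fun _ => (1 : ℝ))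
        =ᵐ[Pr] fun ω => (K (X n ω)).real A

/-- The distance `‖μ - ν‖_TV = sup_A |μ(A) - ν(A)|`. -/
noncomputable def tvDist (μ ν : Measure E) : ℝ≥0∞ :=
  ⨆ (A : Set E) (_ : MeasurableSet A), ENNReal.ofReal |μ.real A - ν.real A|

/-- Geometric ergodicity: there are a probability measure `Π` and `r ∈ (0,1)` such that
`V(x) = sup_n r^{-n} ‖P^n(x,·) - Π‖_TV` is `Π`-integrable. -/
def GeometricallyErgodic (P : Kernel E E) : Prop :=
  ∃ (Pi : Measure E) (r : ℝ), IsProbabilityMeasure Pi ∧ 0 < r ∧ r < 1 ∧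
    AEMeasurable (fun x => ⨆ n : ℕ, ENNReal.ofReal ((r ^ n)⁻¹) * tvDist ((P ^ n) x) Pi) Pi ∧
    ∫⁻ x, ⨆ n : ℕ, ENNReal.ofReal ((r ^ n)⁻¹) * tvDist ((P ^ n) x) Pi ∂Pi < ∞

end Markov

end MpCN

/-!
Everything reduces to one symmetry: inversion of matrices carries the proposal at `S` to the
proposal at `S⁻¹` (`isConjugate_proposal`). A Metropolis kernel depends only on its proposal and on
the ratios of target densities, so inversion then conjugates the MpCN kernel with density `π` to the
one with density `S ↦ π (S⁻¹)`, and conjugate kernels have corresponding Markov chains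
(`IsMarkovChain.of_isConjugate`) and are simultaneously geometrically ergodic
(`IsConjugate.geometricallyErgodic_iff`).

Since `(ε ∘ S)⁻¹ = ε⁻¹ ∘ S⁻¹`, the symmetry of the proposal is the invariance of the increment law
under inversion, which has two sources.

* The reference measure is invariant (`refMeasure_map_inv`). The derivative of inversion at `S` is
  `X ↦ -S⁻¹ X S⁻¹` on symmetric matrices, and diagonalizing `S⁻¹` shows that the determinant of
  this map is `± det(S)^{-(q+1)}` (`det_congruence`).
* The increment density is invariant (`incrementDensity_inv`). Multiplying
  `I + ε⁻¹ - ρ^{1/2} (U₁ ε^{-1/2} + ε^{-1/2} U₁ᵀ)` by `ε^{1/2}` on both sides replaces `ε⁻¹` by `ε`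
  and `U₁` by its transpose. The block `U₁` is a corner of a Haar distributed orthogonal matrix,
  whose transpose, being its inverse, is Haar distributed as well
  (`lintegral_stiefelUniform_transpose`).

For Wishart targets it remains to note that `S ↦ S⁻¹` turns the Wishart density with parameter `T`
into the Inverse-Wishart density with parameter `T⁻¹`.
-/

namespace MpCN

/-! ### Inversion and the operation `∘` -/

section Inversion

variable {q : ℕ}

theorem inv_val (S : SPD q) : (S⁻¹).1 = S.1⁻¹ := rfl

theorem isUnit_det (S : SPD q) : IsUnit S.1.det := S.2.det_pos.ne'.isUnit

theorem det_inv_val (S : SPD q) : (S⁻¹).1.det = S.1.det⁻¹ := by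
  rw [inv_val, Matrix.det_nonsing_inv, Ring.inverse_eq_inv']

theorem transpose_val (S : SPD q) : S.1.transpose = S.1 := by
  simpa [Matrix.IsHermitian] using S.2.isHermitian

theorem inv_inv_val (S : SPD q) : S⁻¹⁻¹ = S :=
  Subtype.ext (Matrix.nonsing_inv_nonsing_inv _ (isUnit_det S))

theorem continuous_inv : Continuous fun S : SPD q => S⁻¹ := by
  refine Continuous.subtype_mk (f := fun S : SPD q => S.1⁻¹) ?_ fun S => S.2.inv
  simp_rw [Matrix.inv_def, Ring.inverse_eq_inv']
  exact (continuous_subtype_val.matrix_det.inv₀ fun S => S.2.det_pos.ne').smul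
    continuous_subtype_val.matrix_adjugate

/-- Inversion as a measurable involution of `P⁺(q)`. -/
noncomputable def invEquiv (q : ℕ) : SPD q ≃ᵐ SPD q where
  toFun S := S⁻¹
  invFun S := S⁻¹
  left_inv := inv_inv_val
  right_inv := inv_inv_val
  measurable_toFun := continuous_inv.measurable
  measurable_invFun := continuous_inv.measurable

@[simp]
theorem invEquiv_apply (S : SPD q) : invEquiv q S = S⁻¹ := rfl

open scoped MatrixOrder in
theorem sqrt_inv (S : SPD q) : sqrt S⁻¹ = (sqrt S)⁻¹ := by
  refine Subtype.ext ?_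
  change CFC.sqrt (S⁻¹).1 = _
  have h : (S⁻¹).1 = ((sqrt S)⁻¹).1 * ((sqrt S)⁻¹).1 := by
    rw [inv_val, inv_val, ← Matrix.mul_inv_rev, sqrt_mul_sqrt]
  rw [h]
  exact CFC.sqrt_mul_self _ ((sqrt S)⁻¹).2.posSemidef.nonneg

theorem circ_inv (A B : SPD q) : (circ A B)⁻¹ = circ A⁻¹ B⁻¹ := by
  refine Subtype.ext ?_
  change ((sqrt B).1 * A.1 * (sqrt B).1)⁻¹ = (sqrt B⁻¹).1 * A.1⁻¹ * (sqrt B⁻¹).1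
  rw [sqrt_inv, inv_val, Matrix.mul_inv_rev, Matrix.mul_inv_rev, mul_assoc]

end Inversion

/-! ### The Jacobian of inversion on symmetric matrices -/

section Jacobian

variable {q : ℕ}

/-- The index set `{(i,j) : i ≤ j}` of the coordinates of a symmetric matrix. -/
abbrev UpperIndex (q : ℕ) : Type := {ij : Fin q × Fin q // ij.1 ≤ ij.2}

/-- The symmetric matrix with given entries on and above the diagonal. -/
def symOfUpper (q : ℕ) : (UpperIndex q → ℝ) →ₗ[ℝ] Matrix (Fin q) (Fin q) ℝ where
  toFun v := Matrix.of fun i j => v ⟨(min i j, max i j), min_le_max⟩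
  map_add' _ _ := rfl
  map_smul' _ _ := rfl

/-- The entries of a matrix on and above the diagonal. -/
def upperPart (q : ℕ) : Matrix (Fin q) (Fin q) ℝ →ₗ[ℝ] (UpperIndex q → ℝ) where
  toFun A ij := A ij.1.1 ij.1.2
  map_add' _ _ := rfl
  map_smul' _ _ := rfl

theorem symOfUpper_apply (v : UpperIndex q → ℝ) (i j : Fin q) :
    symOfUpper q v i j = v ⟨(min i j, max i j), min_le_max⟩ := rfl

theorem upperPart_apply (A : Matrix (Fin q) (Fin q) ℝ) (ij : UpperIndex q) :
    upperPart q A ij = A ij.1.1 ij.1.2 := rfl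

theorem symOfUpper_transpose (v : UpperIndex q → ℝ) :
    (symOfUpper q v).transpose = symOfUpper q v := by
  ext i j
  simp only [Matrix.transpose_apply, symOfUpper_apply, min_comm, max_comm]

theorem symOfUpper_upperPart {A : Matrix (Fin q) (Fin q) ℝ} (hA : A.transpose = A) :
    symOfUpper q (upperPart q A) = A := by
  ext i j
  rcases le_total i j with h | h
  · simp [symOfUpper_apply, upperPart_apply, h]
  · simpa [symOfUpper_apply, upperPart_apply, h] using congrFun (congrFun hA i) j

theorem upperPart_symOfUpper (v : UpperIndex q → ℝ) : upperPart q (symOfUpper q v) = v := by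
  ext ⟨⟨i, j⟩, h⟩
  simp only at h
  simp [symOfUpper_apply, upperPart_apply, h]

/-- The congruence action `X ↦ A X Aᵀ` on symmetric matrices, in the coordinates `X_{ij}`,
`i ≤ j`. -/
def congruence (A : Matrix (Fin q) (Fin q) ℝ) : (UpperIndex q → ℝ) →ₗ[ℝ] (UpperIndex q → ℝ) :=
  upperPart q ∘ₗ LinearMap.mulLeftRight ℝ (A, A.transpose) ∘ₗ symOfUpper q

theorem congruence_apply (A : Matrix (Fin q) (Fin q) ℝ) (v : UpperIndex q → ℝ) :
    congruence A v = upperPart q (A * symOfUpper q v * A.transpose) := rfl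

theorem congruence_mul (A B : Matrix (Fin q) (Fin q) ℝ) :
    congruence (A * B) = congruence A ∘ₗ congruence B := by
  ext1
  ext1
  simp only [LinearMap.comp_apply, congruence_apply]
  rw [symOfUpper_upperPart]
  · simp only [Matrix.transpose_mul, mul_assoc]
  · simp only [Matrix.transpose_mul, Matrix.transpose_transpose, symOfUpper_transpose, mul_assoc]

theorem congruence_one : congruence (1 : Matrix (Fin q) (Fin q) ℝ) = LinearMap.id := by
  refine LinearMap.ext fun v => ?_
  simp [congruence_apply, upperPart_symOfUpper]

theorem prod_upperIndex (d : Fin q → ℝ) :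
    ∏ ij : UpperIndex q, d ij.1.1 * d ij.1.2 = (∏ i, d i) ^ (q + 1) := by
  have h1 : ∏ ij : UpperIndex q, d ij.1.1 = ∏ i, d i ^ (Finset.Ici i).card := by
    rw [← Finset.prod_subtype (Finset.univ.filter fun ij : Fin q × Fin q => ij.1 ≤ ij.2)
      (by simp) (fun ij : Fin q × Fin q => d ij.1), Finset.prod_filter, Fintype.prod_prod_type]
    refine Finset.prod_congr rfl fun i _ => ?_
    simp only [← Finset.prod_filter, Finset.prod_const]
    congr 2
    ext; simp
  have h2 : ∏ ij : UpperIndex q, d ij.1.2 = ∏ i, d i ^ (Finset.Iic i).card := by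
    rw [← Finset.prod_subtype (Finset.univ.filter fun ij : Fin q × Fin q => ij.1 ≤ ij.2)
      (by simp) (fun ij : Fin q × Fin q => d ij.2), Finset.prod_filter,
      Fintype.prod_prod_type_right]
    refine Finset.prod_congr rfl fun i _ => ?_
    simp only [← Finset.prod_filter, Finset.prod_const]
    congr 2
    ext; simp
  rw [Finset.prod_mul_distrib, h1, h2, ← Finset.prod_mul_distrib, ← Finset.prod_pow]
  refine Finset.prod_congr rfl fun i _ => ?_
  rw [← pow_add, Fin.card_Ici, Fin.card_Iic]
  congr 1
  omega

theorem det_congruence_diagonal (d : Fin q → ℝ) :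
    LinearMap.det (congruence (Matrix.diagonal d)) = (∏ i, d i) ^ (q + 1) := by
  have h : congruence (Matrix.diagonal d) =
      Matrix.toLin' (Matrix.diagonal fun ij : UpperIndex q => d ij.1.1 * d ij.1.2) := by
    refine LinearMap.ext fun v => ?_
    ext ⟨⟨i, j⟩, h⟩
    simp only at h
    simp only [congruence_apply, Matrix.diagonal_transpose, upperPart_apply,
      Matrix.mul_diagonal, Matrix.diagonal_mul, Matrix.toLin'_apply,
      Matrix.mulVec_diagonal, symOfUpper_apply, min_eq_left h, max_eq_right h]
    ring
  rw [h, LinearMap.det_toLin', Matrix.det_diagonal, prod_upperIndex]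

/-- The congruence by `A` has determinant `det(A)^{q+1}` for symmetric `A`: both sides are invariant
under orthogonal conjugation, so that `A` may be taken diagonal. -/
theorem det_congruence {A : Matrix (Fin q) (Fin q) ℝ} (hA : A.IsHermitian) :
    LinearMap.det (congruence A) = A.det ^ (q + 1) := by
  set U : Matrix (Fin q) (Fin q) ℝ := hA.eigenvectorUnitary.1
  set D := Matrix.diagonal hA.eigenvalues
  have hU : star U * U = 1 := Unitary.coe_star_mul_self hA.eigenvectorUnitary
  have hAU : A = U * D * star U := by
    have h := hA.spectral_theorem
    rw [Unitary.conjStarAlgAut_apply] at h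
    exact h
  have hU' : LinearMap.det (congruence U) * LinearMap.det (congruence (star U)) = 1 := by
    rw [mul_comm, ← LinearMap.det_comp, ← congruence_mul, hU, congruence_one, LinearMap.det_id]
  have hdet : A.det = ∏ i, hA.eigenvalues i := by
    simpa using hA.det_eq_prod_eigenvalues
  rw [hdet, ← det_congruence_diagonal]
  conv_lhs => rw [hAU, congruence_mul, congruence_mul, LinearMap.det_comp, LinearMap.det_comp]
  rw [mul_right_comm, hU', one_mul]

theorem symOfUpper_upperCoords (S : SPD q) : symOfUpper q (upperCoords S) = S.1 :=
  symOfUpper_upperPart (transpose_val S)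

open scoped Matrix.Norms.Operator in
/-- The derivative of inversion at `S` is `X ↦ -S⁻¹ X S⁻¹`. -/
theorem hasFDerivAt_inv_coords (S : SPD q) :
    HasFDerivAt (fun v => upperPart q (symOfUpper q v)⁻¹)
      (-(LinearMap.toContinuousLinearMap (congruence S.1⁻¹))) (upperCoords S) := by
  let u : (Matrix (Fin q) (Fin q) ℝ)ˣ := Matrix.nonsingInvUnit S.1 (isUnit_det S)
  have h1 : HasFDerivAt (symOfUpper q) (LinearMap.toContinuousLinearMap (symOfUpper q))
      (upperCoords S) := (LinearMap.toContinuousLinearMap (symOfUpper q)).hasFDerivAt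
  have h2 := hasFDerivAt_ringInverse (𝕜 := ℝ) u
  have h3 : ∀ A, HasFDerivAt (upperPart q) (LinearMap.toContinuousLinearMap (upperPart q)) A :=
    fun A => (LinearMap.toContinuousLinearMap (upperPart q)).hasFDerivAt
  have hu : (u : Matrix (Fin q) (Fin q) ℝ) = symOfUpper q (upperCoords S) :=
    (symOfUpper_upperCoords S).symm
  have hu' : ((u⁻¹ : (Matrix (Fin q) (Fin q) ℝ)ˣ) : Matrix (Fin q) (Fin q) ℝ) = S.1⁻¹ := rfl
  rw [hu] at h2
  have h := (h3 _).comp (upperCoords S) (h2.comp (upperCoords S) h1)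
  have hf : (fun v => upperPart q (symOfUpper q v)⁻¹) =
      upperPart q ∘ Ring.inverse ∘ symOfUpper q := by
    funext v
    simp [Matrix.nonsing_inv_eq_ringInverse]
  rw [hf]
  refine h.congr_fderiv ?_
  refine ContinuousLinearMap.ext fun v => ?_
  have ht : S.1⁻¹.transpose = S.1⁻¹ := transpose_val S⁻¹
  change upperPart q (-(((u⁻¹ : (Matrix (Fin q) (Fin q) ℝ)ˣ) : Matrix (Fin q) (Fin q) ℝ) *
    symOfUpper q v * ((u⁻¹ : (Matrix (Fin q) (Fin q) ℝ)ˣ) : Matrix (Fin q) (Fin q) ℝ))) =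
    -congruence S.1⁻¹ v
  rw [hu', map_neg, congruence_apply, ht]

theorem abs_det_fderiv_inv (S : SPD q) :
    |(-(LinearMap.toContinuousLinearMap (congruence S.1⁻¹))).det| = (S.1.det⁻¹) ^ (q + 1) := by
  have h : ((-(LinearMap.toContinuousLinearMap (congruence S.1⁻¹)) :
      (UpperIndex q → ℝ) →L[ℝ] (UpperIndex q → ℝ)) : (UpperIndex q → ℝ) →ₗ[ℝ] (UpperIndex q → ℝ)) =
      (-1 : ℝ) • congruence S.1⁻¹ := by
    refine LinearMap.ext fun v => ?_
    simp
  have hd : S.1⁻¹.det = S.1.det⁻¹ := det_inv_val S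
  rw [ContinuousLinearMap.det, h, LinearMap.det_smul, det_congruence S.2.inv.isHermitian, abs_mul,
    abs_pow, abs_neg, abs_one, one_pow, one_mul, hd,
    abs_of_pos (pow_pos (inv_pos.mpr S.2.det_pos) _)]

theorem setLIntegral_lebSPD (w : (UpperIndex q → ℝ) → ℝ≥0∞) (A : Set (SPD q)) :
    ∫⁻ S in A, w (upperCoords S) ∂(lebSPD q) = ∫⁻ v in upperCoords '' A, w v := by
  have he := measurableEmbedding_upperCoords q
  have h1 : upperCoords ⁻¹' (upperCoords '' A) = A := he.injective.preimage_image A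
  have h2 : ((lebSPD q).restrict A).map upperCoords = volume.restrict (upperCoords '' A) := by
    conv_lhs => rw [← h1]
    rw [← he.restrict_map, lebSPD, he.map_comap, Measure.restrict_restrict_of_subset
      (Set.image_subset_range _ _)]
  rw [← h2, he.lintegral_map]

/-- Inversion has Jacobian `det(S)^{-(q+1)}`, which is what the density `det(S)^{-(q+1)/2}` of the
reference measure picks up under `S ↦ S⁻¹`. -/
theorem refMeasure_map_inv (q : ℕ) : (refMeasure q).map (fun S => S⁻¹) = refMeasure q := by
  ext A hA
  set w : (UpperIndex q → ℝ) → ℝ≥0∞ := fun v =>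
    ENNReal.ofReal ((symOfUpper q v).det ^ (-((q : ℝ) + 1) / 2)) with hw
  have href : ∀ B, MeasurableSet B → refMeasure q B = ∫⁻ v in upperCoords '' B, w v := by
    intro B hB
    rw [refMeasure, withDensity_apply _ hB, ← setLIntegral_lebSPD]
    simp only [hw, symOfUpper_upperCoords]
  have hB : MeasurableSet ((fun S : SPD q => S⁻¹) ⁻¹' A) := continuous_inv.measurable hA
  rw [Measure.map_apply continuous_inv.measurable hA, href _ hB, href _ hA]
  set f : (UpperIndex q → ℝ) → (UpperIndex q → ℝ) := fun v => upperPart q (symOfUpper q v)⁻¹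
  have hf : ∀ S : SPD q, f (upperCoords S) = upperCoords S⁻¹ := fun S => by
    simp only [f, symOfUpper_upperCoords]; rfl
  have himage : upperCoords '' ((fun S : SPD q => S⁻¹) ⁻¹' A) = f '' (upperCoords '' A) := by
    rw [← Set.image_comp]
    ext v
    constructor
    · rintro ⟨S, hS, rfl⟩
      exact ⟨S⁻¹, hS, by simp [hf, inv_inv_val]⟩
    · rintro ⟨S, hS, rfl⟩
      exact ⟨S⁻¹, by simpa [inv_inv_val] using hS, by simp [hf]⟩
  have hs : MeasurableSet (upperCoords '' A) :=
    (measurableEmbedding_upperCoords q).measurableSet_image.mpr hA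
  rw [himage, lintegral_image_eq_lintegral_abs_det_fderiv_mul volume hs
    (f' := fun v => -(LinearMap.toContinuousLinearMap (congruence (symOfUpper q v)⁻¹)))]
  · refine setLIntegral_congr_fun hs ?_
    rintro _ ⟨S, -, rfl⟩
    have hS := S.2.det_pos
    simp only [hw, hf, symOfUpper_upperCoords, abs_det_fderiv_inv, det_inv_val]
    rw [← ENNReal.ofReal_mul (by positivity), Real.inv_rpow hS.le, ← Real.rpow_neg hS.le, inv_pow,
      ← Real.rpow_natCast, ← Real.rpow_neg hS.le, ← Real.rpow_add hS]
    congr 2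
    push_cast
    ring
  · rintro _ ⟨S, -, rfl⟩
    rw [symOfUpper_upperCoords]
    exact (hasFDerivAt_inv_coords S).hasFDerivWithinAt
  · rintro _ ⟨S, -, rfl⟩ _ ⟨T, -, rfl⟩ h
    rw [hf, hf] at h
    have := (measurableEmbedding_upperCoords q).injective h
    rw [← inv_inv_val S, this, inv_inv_val]

theorem refMeasure_withDensity_map_inv (f : SPD q → ℝ≥0∞) :
    ((refMeasure q).withDensity f).map (fun S => S⁻¹) =
      (refMeasure q).withDensity fun S => f S⁻¹ := by
  ext A hA
  have hm : (refMeasure q).map (invEquiv q) = refMeasure q := refMeasure_map_inv q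
  rw [Measure.map_apply continuous_inv.measurable hA,
    withDensity_apply _ (continuous_inv.measurable hA), withDensity_apply _ hA]
  conv_rhs => rw [← hm, (invEquiv q).restrict_map, lintegral_map_equiv]
  simp only [invEquiv_apply, inv_inv_val]
  rfl

end Jacobian

/-! ### Inversion invariance of Haar measure on a compact group -/

section Haar

/-- A compact group is unimodular: the right translates and then the inverse of the Haar probability
measure are again Haar probability measures. -/
theorem isInvInvariant_of_isProbabilityMeasure {G : Type*} [Group G] [TopologicalSpace G]
    [IsTopologicalGroup G] [CompactSpace G] [MeasurableSpace G] [BorelSpace G] (μ : Measure G)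
    [μ.IsHaarMeasure] [IsProbabilityMeasure μ] : μ.IsInvInvariant := by
  have hright : μ.IsMulRightInvariant := ⟨fun g => by
    have : IsProbabilityMeasure (μ.map (· * g)) :=
      Measure.isProbabilityMeasure_map (measurable_mul_const g).aemeasurable
    exact Measure.isHaarMeasure_eq_of_isProbabilityMeasure _ _⟩
  have hprob : IsProbabilityMeasure μ.inv :=
    Measure.isProbabilityMeasure_map measurable_inv.aemeasurable
  have hHaar : μ.inv.IsHaarMeasure := { lt_top_of_isCompact := fun K _ => measure_lt_top _ K }
  exact ⟨Measure.isHaarMeasure_eq_of_isProbabilityMeasure _ _⟩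

end Haar

/-! ### Kernels conjugate under a measurable equivalence -/

section Conjugate

variable {E : Type*} [MeasurableSpace E]

/-- The kernel `K'` is the image of the kernel `K` under the change of variable `e`. -/
def IsConjugate (e : E ≃ᵐ E) (K K' : Kernel E E) : Prop :=
  ∀ x, K' (e x) = (K x).map e

variable {e : E ≃ᵐ E} {K K' : Kernel E E}

theorem IsConjugate.symm (h : IsConjugate e K K') : IsConjugate e.symm K' K := fun x => by
  obtain ⟨y, rfl⟩ := e.surjective x
  rw [h, e.symm_apply_apply, Measure.map_map e.symm.measurable e.measurable,
    e.symm_comp_self, Measure.map_id]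

theorem IsConjugate.pow (h : IsConjugate e K K') (n : ℕ) : IsConjugate e (K ^ n) (K' ^ n) := by
  induction n with
  | zero =>
    intro x
    change Kernel.id (e x) = (Kernel.id x).map e
    rw [Kernel.id_apply, Kernel.id_apply, Measure.map_dirac' e.measurable]
  | succ n ih =>
    intro x
    ext A hA
    rw [Kernel.pow_succ_apply_eq_lintegral _ _ _ hA, ih x, lintegral_map_equiv,
      Measure.map_apply e.measurable hA,
      Kernel.pow_succ_apply_eq_lintegral _ _ _ (e.measurable hA)]
    refine lintegral_congr fun y => ?_
    rw [h, Measure.map_apply e.measurable hA]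

theorem IsConjugate.metropolisKernel [IsSFiniteKernel K] [IsSFiniteKernel K']
    (h : IsConjugate e K K') {π π' : E → ℝ≥0} (hπ : Measurable π) (hπ' : Measurable π')
    (hππ' : ∀ x, π' (e x) = π x) :
    IsConjugate e (MpCN.metropolisKernel K π) (MpCN.metropolisKernel K' π') := by
  have ha : ∀ x y, acceptProb π' (e x) (e y) = acceptProb π x y := fun x y => by
    simp only [acceptProb, hππ']
  intro x
  ext A hA
  rw [Measure.map_apply e.measurable hA, metropolisKernel_apply _ hπ', metropolisKernel_apply _ hπ,
    h, e.restrict_map, lintegral_map_equiv, lintegral_map_equiv,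
    Measure.dirac_apply' _ hA, Measure.dirac_apply' _ (e.measurable hA)]
  simp only [ha]
  rfl

theorem tvDist_map (e : E ≃ᵐ E) (μ ν : Measure E) :
    tvDist (μ.map e) (ν.map e) = tvDist μ ν := by
  have hle : ∀ (e : E ≃ᵐ E) (μ ν : Measure E), tvDist (μ.map e) (ν.map e) ≤ tvDist μ ν := by
    intro e μ ν
    refine iSup₂_le fun A hA => ?_
    rw [map_measureReal_apply e.measurable hA, map_measureReal_apply e.measurable hA]
    exact le_iSup₂ (f := fun (A : Set E) (_ : MeasurableSet A) =>
      ENNReal.ofReal |μ.real A - ν.real A|) (e ⁻¹' A) (e.measurable hA)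
  refine le_antisymm (hle e μ ν) ?_
  have h := hle e.symm (μ.map e) (ν.map e)
  rwa [Measure.map_map e.symm.measurable e.measurable, Measure.map_map e.symm.measurable
    e.measurable, e.symm_comp_self, Measure.map_id, Measure.map_id] at h

theorem GeometricallyErgodic.of_isConjugate (h : IsConjugate e K K')
    (hK : GeometricallyErgodic K) : GeometricallyErgodic K' := by
  obtain ⟨Pi, r, hPi, hr0, hr1, hV, hint⟩ := hK
  have hV' : ∀ x, ⨆ n : ℕ, ENNReal.ofReal ((r ^ n)⁻¹) * tvDist ((K' ^ n) (e x)) (Pi.map e) =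
      ⨆ n : ℕ, ENNReal.ofReal ((r ^ n)⁻¹) * tvDist ((K ^ n) x) Pi := fun x => by
    simp only [h.pow _ x, tvDist_map]
  refine ⟨Pi.map e, r, Measure.isProbabilityMeasure_map e.measurable.aemeasurable, hr0, hr1, ?_, ?_⟩
  · rw [e.measurableEmbedding.aemeasurable_map_iff]
    exact hV.congr (Filter.Eventually.of_forall fun x => (hV' x).symm)
  · rw [lintegral_map_equiv]
    simpa only [hV'] using hint

theorem IsConjugate.geometricallyErgodic_iff (h : IsConjugate e K K') :
    GeometricallyErgodic K ↔ GeometricallyErgodic K' :=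
  ⟨.of_isConjugate h, .of_isConjugate h.symm⟩

theorem IsMarkovChain.of_isConjugate (h : IsConjugate e K K') {Ω : Type*} [MeasurableSpace Ω]
    {Pr : Measure Ω} {X : ℕ → Ω → E} (hX : IsMarkovChain Pr X K) :
    IsMarkovChain Pr (fun n ω => e (X n ω)) K' := by
  refine ⟨fun n => e.measurable.comp (hX.1 n), fun n A hA => ?_⟩
  -- `e` is a measurable equivalence, so that both chains generate the same filtration
  have hcomap : ∀ i, MeasurableSpace.comap (fun ω => e (X i ω)) inferInstance =
      MeasurableSpace.comap (X i) inferInstance := fun i => by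
    conv_rhs => rw [← e.measurableEmbedding.comap_eq, MeasurableSpace.comap_comp]
    rfl
  simp only [hcomap]
  filter_upwards [hX.2 n (e ⁻¹' A) (e.measurable hA)] with ω hω
  rw [h, map_measureReal_apply e.measurable hA]
  exact hω

end Conjugate

/-! ### Inversion invariance of the increment law -/

section Increment

variable {p q : ℕ}

theorem continuous_firstColumns (hqp : q ≤ p) : Continuous (firstColumns hqp) :=
  Continuous.subtype_mk (continuous_subtype_val.matrix_submatrix _ _) _

/-- The top `q × q` block of a uniform element of `O(p,q)` has the same law as its transpose: it is
the corner of a Haar distributed orthogonal matrix `g`, and `gᵀ = g⁻¹` is Haar distributed too. -/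
theorem lintegral_stiefelUniform_transpose (hqp : q ≤ p) {D : Matrix (Fin q) (Fin q) ℝ → ℝ}
    (hD : Continuous D) {φ : ℝ → ℝ≥0∞} (hφ : Measurable φ) :
    ∫⁻ U : Stiefel p q, φ (D (U.1.submatrix (Fin.castLE hqp) id).transpose)
        ∂(stiefelUniform hqp) =
      ∫⁻ U : Stiefel p q, φ (D (U.1.submatrix (Fin.castLE hqp) id)) ∂(stiefelUniform hqp) := by
  have hprob : IsProbabilityMeasure (Measure.haarMeasure (⊤ : TopologicalSpace.PositiveCompacts
      (Matrix.orthogonalGroup (Fin p) ℝ))) := ⟨by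
    simpa using Measure.haarMeasure_self
      (K₀ := (⊤ : TopologicalSpace.PositiveCompacts (Matrix.orthogonalGroup (Fin p) ℝ)))⟩
  have hinv := isInvInvariant_of_isProbabilityMeasure (Measure.haarMeasure
    (⊤ : TopologicalSpace.PositiveCompacts (Matrix.orthogonalGroup (Fin p) ℝ)))
  have hc : Continuous fun U : Stiefel p q => U.1.submatrix (Fin.castLE hqp) id :=
    continuous_subtype_val.matrix_submatrix _ _
  have hcol := (continuous_firstColumns hqp).measurable
  have h1 : Measurable fun U : Stiefel p q =>
      φ (D (U.1.submatrix (Fin.castLE hqp) id).transpose) :=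
    hφ.comp (hD.comp hc.matrix_transpose).measurable
  have h2 : Measurable fun U : Stiefel p q => φ (D (U.1.submatrix (Fin.castLE hqp) id)) :=
    hφ.comp (hD.comp hc).measurable
  rw [stiefelUniform, lintegral_map h1 hcol, lintegral_map h2 hcol, ← lintegral_inv_eq_self]
  rfl

/-- `det(I + ε - c (Uᵀ ε^{1/2} + ε^{1/2} U))` arises from the same expression at `ε⁻¹` by multiplying
with `ε^{1/2}` on both sides. -/
theorem det_increment_inv (c : ℝ) (ε : SPD q) (U : Matrix (Fin q) (Fin q) ℝ) :
    ε.1.det * (1 + (ε⁻¹).1 - c • (U * (sqrt ε⁻¹).1 + (sqrt ε⁻¹).1 * U.transpose)).det =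
      (1 + ε.1 - c • (U.transpose * (sqrt ε).1 + (sqrt ε).1 * U)).det := by
  set s := (sqrt ε).1 with hs
  have hdet : IsUnit s.det := isUnit_det (sqrt ε)
  have hss : s * s = ε.1 := sqrt_mul_sqrt ε
  have hi : (sqrt ε⁻¹).1 = s⁻¹ := by rw [sqrt_inv, inv_val]
  have hε : (ε⁻¹).1 = s⁻¹ * s⁻¹ := by rw [inv_val, ← hss, Matrix.mul_inv_rev]
  have h : s * (1 + (ε⁻¹).1 - c • (U * (sqrt ε⁻¹).1 + (sqrt ε⁻¹).1 * U.transpose)) * s =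
      1 + ε.1 - c • (U.transpose * s + s * U) := by
    rw [hi, hε, ← hss]
    have h1 : s * (s⁻¹ * s⁻¹) * s = 1 := by
      rw [← mul_assoc, Matrix.mul_nonsing_inv _ hdet, one_mul, Matrix.nonsing_inv_mul _ hdet]
    have h2 : s * (U * s⁻¹) * s = s * U := by
      rw [mul_assoc, mul_assoc U, Matrix.nonsing_inv_mul _ hdet, mul_one]
    have h3 : s * (s⁻¹ * U.transpose) * s = U.transpose * s := by
      rw [← mul_assoc, Matrix.mul_nonsing_inv _ hdet, one_mul]
    simp only [mul_add, add_mul, mul_sub, sub_mul, mul_smul_comm, smul_mul_assoc, mul_one, h1, h2,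
      h3]
    abel_nf
  rw [← h, Matrix.det_mul, Matrix.det_mul, ← hss, Matrix.det_mul]
  ring

theorem incrementDensity_inv (hqp : q ≤ p) (ρ : ℝ) (ε : SPD q) :
    incrementDensity hqp ρ ε⁻¹ = incrementDensity hqp ρ ε := by
  unfold incrementDensity
  congr 1
  let D : Matrix (Fin q) (Fin q) ℝ → ℝ := fun M =>
    (1 + ε.1 - √ρ • (M * (sqrt ε).1 + (sqrt ε).1 * M.transpose)).det
  have hD : Continuous D := by fun_prop
  have hφ : Measurable fun x : ℝ => ENNReal.ofReal (ε.1.det ^ ((p : ℝ) / 2) / x ^ p) := by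
    fun_prop
  refine Eq.trans (lintegral_congr fun U => ?_) (lintegral_stiefelUniform_transpose hqp hD hφ)
  simp only [D, Matrix.transpose_transpose]
  have hε := ε.2.det_pos
  rw [← det_increment_inv, det_inv_val, mul_pow, Real.inv_rpow hε.le, ← div_div]
  congr 2
  have hp : ε.1.det ^ p = ε.1.det ^ ((p : ℝ) / 2) * ε.1.det ^ ((p : ℝ) / 2) := by
    rw [← Real.rpow_add hε, add_halves, Real.rpow_natCast]
  have h0 : ε.1.det ^ ((p : ℝ) / 2) ≠ 0 := (Real.rpow_pos_of_pos hε _).ne'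
  rw [hp]
  field_simp

theorem incrementLaw_map_inv (hqp : q ≤ p) (ρ : ℝ) :
    (incrementLaw hqp ρ).map (fun S => S⁻¹) = incrementLaw hqp ρ := by
  rw [incrementLaw, refMeasure_withDensity_map_inv]
  simp only [incrementDensity_inv]

theorem proposal_apply (hqp : q ≤ p) (ρ : ℝ) (S : SPD q) :
    proposal hqp ρ S = (incrementLaw hqp ρ).map fun ε => circ ε S := rfl

theorem measurable_circ_left (S : SPD q) : Measurable fun ε => circ ε S := by
  have h : Measurable ((fun x : SPD q × SPD q => circ x.2 x.1) ∘ Prod.mk S) :=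
    measurable_circ.comp measurable_prodMk_left
  simpa only [Function.comp_def] using h

theorem isConjugate_proposal (hqp : q ≤ p) (ρ : ℝ) :
    IsConjugate (invEquiv q) (proposal hqp ρ) (proposal hqp ρ) := by
  intro S
  have hcomp : (fun ε => circ ε S⁻¹) ∘ (fun ε : SPD q => ε⁻¹) =
      invEquiv q ∘ fun ε => circ ε S := by
    funext ε
    rw [Function.comp_apply, Function.comp_apply, invEquiv_apply, circ_inv]
  rw [proposal_apply, proposal_apply, invEquiv_apply,
    Measure.map_map (invEquiv q).measurable (measurable_circ_left S), ← hcomp,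
    ← Measure.map_map (measurable_circ_left _) continuous_inv.measurable, incrementLaw_map_inv]

theorem isConjugate_mpcnKernel (hqp : q ≤ p) (ρ : ℝ) {π : SPD q → ℝ≥0} (hπ : Measurable π) :
    IsConjugate (invEquiv q) (mpcnKernel hqp ρ π) (mpcnKernel hqp ρ fun S => π S⁻¹) :=
  (isConjugate_proposal hqp ρ).metropolisKernel hπ (hπ.comp continuous_inv.measurable)
    fun S => by simp only [invEquiv_apply, inv_inv_val]

end Increment

/-! ### Wishart targets -/

section Wishart

variable {q : ℕ}

theorem measurable_wishartDensity (r : ℝ) (T : SPD q) : Measurable (wishartDensity r T) := by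
  have hdet : Measurable fun S : SPD q => S.1.det :=
    (continuous_subtype_val.matrix_det).measurable
  have htr : Measurable fun S : SPD q => (T.1⁻¹ * S.1).trace :=
    (continuous_const.mul continuous_subtype_val).matrix_trace.measurable
  unfold wishartDensity
  fun_prop

theorem wishartDensity_inv (r : ℝ) (T S : SPD q) :
    wishartDensity r T S⁻¹ = invWishartDensity r T⁻¹ S := by
  unfold wishartDensity invWishartDensity
  have hS := Real.rpow_pos_of_pos S.2.det_pos (r / 2)
  have hT := Real.rpow_pos_of_pos T.2.det_pos (r / 2)
  rw [det_inv_val, det_inv_val, inv_val, inv_val, Real.inv_rpow S.2.det_pos.le,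
    Real.inv_rpow T.2.det_pos.le]
  congr 1
  simp only [div_eq_mul_inv, mul_inv]
  ring

theorem wishart_map_inv (r : ℝ) (T : SPD q) :
    (wishart r T).map (fun S => S⁻¹) = invWishart r T⁻¹ := by
  rw [wishart, refMeasure_withDensity_map_inv]
  simp only [wishartDensity_inv]
  rfl

end Wishart

end MpCN

theorem mainTheorem11 {p q : ℕ} (hqp : q ≤ p) (ρ : ℝ) (hρ0 : 0 ≤ ρ) (hρ1 : ρ < 1) :
    -- If `S` is an MpCN chain with target `Pi`, `S⁻¹` is an MpCN chain with target `Pi₋₁`.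
    (∀ (Pi : Measure (MpCN.SPD q)) (π : MpCN.SPD q → ℝ≥0), IsProbabilityMeasure Pi →
      MpCN.HasDensity Pi (MpCN.refMeasure q) π →
        MpCN.HasDensity (Pi.map fun S => S⁻¹) (MpCN.refMeasure q) (fun S => π (S⁻¹)) ∧
        ∀ {Ω : Type*} [MeasurableSpace Ω] (Pr : Measure Ω) [IsProbabilityMeasure Pr]
          (S : ℕ → Ω → MpCN.SPD q),
          MpCN.IsMarkovChain Pr S (MpCN.mpcnKernel hqp ρ π) →
            MpCN.IsMarkovChain Pr (fun n ω => (S n ω)⁻¹)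
              (MpCN.mpcnKernel hqp ρ fun S => π (S⁻¹))) ∧
    -- Geometric ergodicity transfers between the targets `Pi` and `Pi₋₁`.
    (∀ (Pi : Measure (MpCN.SPD q)) (π : MpCN.SPD q → ℝ≥0), IsProbabilityMeasure Pi →
      MpCN.HasDensity Pi (MpCN.refMeasure q) π →
        (MpCN.GeometricallyErgodic (MpCN.mpcnKernel hqp ρ π) ↔
          MpCN.GeometricallyErgodic (MpCN.mpcnKernel hqp ρ fun S => π (S⁻¹)))) ∧
    -- In particular, it transfers between Wishart and Inverse-Wishart targets.
    (∀ (r : ℝ) (T : MpCN.SPD q), (q : ℝ) - 1 < r →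
      (MpCN.wishart r T).map (fun S => S⁻¹) = MpCN.invWishart r (T⁻¹) ∧
        (MpCN.GeometricallyErgodic (MpCN.mpcnKernel hqp ρ (MpCN.wishartDensity r T)) ↔
          MpCN.GeometricallyErgodic
            (MpCN.mpcnKernel hqp ρ (MpCN.invWishartDensity r (T⁻¹))))) := by
  refine ⟨fun Pi π _ hPi => ⟨⟨hPi.1.comp MpCN.continuous_inv.measurable, ?_⟩, ?_⟩,
    fun Pi π _ hPi => (MpCN.isConjugate_mpcnKernel hqp ρ hPi.1).geometricallyErgodic_iff,
    fun r T _ => ⟨MpCN.wishart_map_inv r T, ?_⟩⟩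
  · rw [hPi.2, MpCN.refMeasure_withDensity_map_inv]
  · intro Ω _ Pr _ S hS
    exact hS.of_isConjugate (MpCN.isConjugate_mpcnKernel hqp ρ hPi.1)
  · have h := (MpCN.isConjugate_mpcnKernel hqp ρ
      (MpCN.measurable_wishartDensity r T)).geometricallyErgodic_iff
    simpa only [MpCN.wishartDensity_inv] using h
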